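/- **Conventions.** A *Fraïssé structure* is a non-empty countable structure $\mathbf F$ in a relational first-order language such that every isomorphism between finite substructures of $\mathbf F$ extends to an automorphism. Let $G=\mathrm{Aut}(\mathbf F)$ with the topology of pointwise convergence ($\mathbf F$ discrete). $\mathrm{RUC}_b(G)$ is the C$^*$-algebra, with the supremum norm, of bounded functions $f:G\to\mathbb C$ that are uniformly continuous for the right uniformity (generated by the entourages $\{(g,h): gh^{-1}\in U\}$, $U$ a neighbourhood of the identity), and $G$ acts on it by $(g\cdot f)(h)=f(g^{-1}h)$. Let $\mathcal A\subset \mathrm{RUC}_b(G)$ be a closed C$^*$-subalgebra that contains the constants and is invariant under this action. $G^{\mathcal A}$ is the Gelfand space of $\mathcal A$ (the characters of $\mathcal A$, with the weak-$*$ topology), on which $G$ acts by $(g\cdot\phi)(f)=\phi(g^{-1}\cdot f)$; this is a $G$-flow, that is, a continuous action on a compact Hausdorff space. A *factor* of a $G$-flow $X$ is a $G$-flow $Y$ that admits a $G$-equivariant continuous surjection $X\to Y$. A space is *zero-dimensional* if its clopen sets form a basis. For $\varepsilon>0$, $(\mathcal A)_\varepsilon=\{f\in \mathrm{RUC}_b(G):\exists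 a\in\mathcal A,\ \|f-a\|_\infty<\varepsilon\}$. $\mathrm{Age}(\mathbf F)$ is the set of non-empty finite substructures of $\mathbf F$, and for a structure $\mathbf A$, $\binom{\mathbf F}{\mathbf A}$ is the set of embeddings of $\mathbf A$ into $\mathbf F$. A *finite colouring* of $\binom{\mathbf F}{\mathbf A}$, $\mathbf A\in\mathrm{Age}(\mathbf F)$, is a map $\bar\chi:\binom{\mathbf F}{\mathbf A}\to\mathbb C$ with finite range; it is identified with the function $\chi\in\mathrm{RUC}_b(G)$, $\chi(g)=\bar\chi(g^{-1}|_{\mathbf A})$. For $\mathcal F\subset \mathrm{RUC}_b(G)$, $\mathbf F$ has the *Ramsey property* (resp. *the Ramsey property up to $\delta$*) *for the finite colourings in $\mathcal F$* if for all $\mathbf A,\mathbf B\in\mathrm{Age}(\mathbf F)$ and every finite set $\mathcal C\subset\mathcal F$ of finite colourings of $\binom{\mathbf F}{\mathbf A}$ there is $b\in\binom{\mathbf F}{\mathbf B}$ such that for every $\chi\in\mathcal C$ and all $a,a'\in\binom{\mathbf F}{\mathbf A}$ with ranges contained in $b(\mathbf B)$, $\bar\chi(a)=\bar\chi(a')$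 (resp. $|\bar\chi(a)-\bar\chi(a')|<\delta$). **Theorem.** Let $\mathbf F$ be a Fraïssé structure and $\mathcal A$ a unital, left-invariant, closed C$^*$-subalgebra of $\mathrm{RUC}_b(\mathrm{Aut}(\mathbf F))$. The following are equivalent: 1. The flow $\mathrm{Aut}(\mathbf F)\curvearrowright\mathrm{Aut}(\mathbf F)^{\mathcal A}$ has a fixed point. 2. For every $\varepsilon>0$, $\mathbf F$ has the Ramsey property up to $2\varepsilon$ for the finite colourings in $(\mathcal A)_\varepsilon$. They imply the following statements, which are equivalent to each other: 3. Every zero-dimensional factor of $\mathrm{Aut}(\mathbf F)\curvearrowright\mathrm{Aut}(\mathbf F)^{\mathcal A}$ has a fixed point. 4. $\mathbf F$ has the Ramsey property for the finite colourings in $\mathcal A$. If the finite colourings belonging to $\mathcal A$ are dense in $\mathcal A$, then all four statements are equivalent. -/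

import Mathlib

open Topology BoundedContinuousFunction FirstOrder

universe u v w

noncomputable section

namespace FraisseFlow

/-! ### Right uniformly continuous functions and Gelfand compactifications -/

section Groups

variable (G : Type u) [Group G] [TopologicalSpace G] [IsTopologicalGroup G]

/-- The unital star-algebra of bounded functions `G → ℂ` that are uniformly continuous for the
right uniformity of `G`, whose entourages are generated by the sets of pairs `(g, h)` such that
`h * g⁻¹` lies in a given neighbourhood of the identity. -/
def RUCb : StarSubalgebra ℂ (G →ᵇ ℂ) where
  carrier := {f | @UniformContinuous G ℂ (IsTopologicalGroup.rightUniformSpace G) _ f}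
  mul_mem' {f g} hf hg := by
    let _ := IsTopologicalGroup.rightUniformSpace G
    have hb : Bornology.IsBounded (Set.range f ×ˢ Set.range g) :=
      f.isBounded_range.prod g.isBounded_range
    have h := hb.uniformContinuousOn_smul
    have h2 : UniformContinuous (fun x => (f x, g x)) := UniformContinuous.prodMk hf hg
    have h3 := UniformContinuousOn.comp h (uniformContinuousOn_univ.2 h2)
      (fun x _ => ⟨⟨x, rfl⟩, ⟨x, rfl⟩⟩)
    exact uniformContinuousOn_univ.1 h3
  add_mem' {f g} hf hg := by
    let _ := IsTopologicalGroup.rightUniformSpace G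
    exact UniformContinuous.add hf hg
  algebraMap_mem' r := by
    let _ := IsTopologicalGroup.rightUniformSpace G
    exact uniformContinuous_const
  star_mem' {f} hf := by
    let _ := IsTopologicalGroup.rightUniformSpace G
    exact (Complex.conjLIE.isometry.uniformContinuous).comp hf

variable {G}

/-- The action by left shift: `(g · f) h = f (g⁻¹ h)`. -/
def leftShift (g : G) (f : G →ᵇ ℂ) : G →ᵇ ℂ :=
  f.compContinuous ⟨fun h => g⁻¹ * h, continuous_const.mul continuous_id⟩

variable (G)

/-- A unital, left-invariant, closed C⋆-subalgebra of `RUCb G` (with the supremum norm). -/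
structure InvSubalgebra extends StarSubalgebra ℂ (G →ᵇ ℂ) where
  le_RUCb : toStarSubalgebra ≤ RUCb G
  isClosed' : IsClosed (toStarSubalgebra : Set (G →ᵇ ℂ))
  leftShift_mem : ∀ (g : G), ∀ f ∈ toStarSubalgebra, leftShift g f ∈ toStarSubalgebra

variable {G}

namespace InvSubalgebra

variable (A : InvSubalgebra G)

instance : IsClosed (A.toStarSubalgebra : Set (G →ᵇ ℂ)) := A.isClosed'

/-- Left shift by `g`, as a star-algebra homomorphism of `A`. -/
def shift (g : G) : A.toStarSubalgebra →⋆ₐ[ℂ] A.toStarSubalgebra where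
  toFun f := ⟨leftShift g f, A.leftShift_mem g f f.2⟩
  map_one' := rfl
  map_mul' _ _ := rfl
  map_zero' := rfl
  map_add' _ _ := rfl
  commutes' _ := rfl
  map_star' _ := rfl

/-- The Gelfand space `G^A`: the space of characters of `A`, with the weak-⋆ topology. It is a
compact Hausdorff space. -/
abbrev Gelfand : Type u := WeakDual.characterSpace ℂ A.toStarSubalgebra

/-- The action of `G` on the Gelfand space: `(g · φ) f = φ (g⁻¹ · f)`. -/
instance : MulAction G A.Gelfand where
  smul g φ := WeakDual.CharacterSpace.compContinuousMap (A.shift g⁻¹) φ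
  one_smul φ := by
    refine Subtype.ext (ContinuousLinearMap.ext fun f => congrArg φ (Subtype.ext ?_))
    refine BoundedContinuousFunction.ext fun x => congrArg f.1 ?_
    simp
  mul_smul g h φ := by
    refine Subtype.ext (ContinuousLinearMap.ext fun f => congrArg φ (Subtype.ext ?_))
    refine BoundedContinuousFunction.ext fun x => congrArg f.1 ?_
    simp [mul_assoc]

theorem smul_apply (g : G) (φ : A.Gelfand) (f : A.toStarSubalgebra) :
    (g • φ) f = φ (A.shift g⁻¹ f) := rfl

/-- The left shift is norm-continuous, because the functions are right uniformly continuous. -/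
theorem continuous_shift_inv (f : A.toStarSubalgebra) :
    Continuous (fun g : G => A.shift g⁻¹ f) := by
  rw [continuous_iff_continuousAt]
  intro g₀
  rw [ContinuousAt, Metric.tendsto_nhds]
  intro ε hε
  have hf : @UniformContinuous G ℂ (IsTopologicalGroup.rightUniformSpace G) _ f.1 :=
    A.le_RUCb f.2
  have h1 := hf (Metric.dist_mem_uniformity (half_pos hε))
  obtain ⟨U, hU, hUf⟩ := h1
  have h2 : Filter.Tendsto (fun g : G => g₀ * g⁻¹) (𝓝 g₀) (𝓝 1) := by
    have : Continuous (fun g : G => g₀ * g⁻¹) := continuous_const.mul continuous_inv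
    simpa using this.tendsto g₀
  filter_upwards [h2 hU] with g hg
  refine lt_of_le_of_lt ?_ (half_lt_self hε)
  refine (BoundedContinuousFunction.dist_le (half_pos hε).le).2 fun x => ?_
  have h3 : ((g⁻¹)⁻¹ * x, (g₀⁻¹)⁻¹ * x) ∈ (fun p : G × G => p.2 * p.1⁻¹) ⁻¹' U := by
    simpa [mul_assoc] using hg
  exact le_of_lt (hUf h3)

/-- The Gelfand compactification is a `G`-flow: the action is jointly continuous. -/
instance : ContinuousSMul G A.Gelfand where
  continuous_smul := by
    refine Continuous.subtype_mk (WeakDual.continuous_of_continuous_eval fun f => ?_) _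
    change Continuous (fun p : G × A.Gelfand => p.2 (A.shift p.1⁻¹ f))
    rw [continuous_iff_continuousAt]
    rintro ⟨g₀, φ₀⟩
    have h1 : Filter.Tendsto (fun p : G × A.Gelfand => p.2 (A.shift g₀⁻¹ f)) (𝓝 (g₀, φ₀))
        (𝓝 (φ₀ (A.shift g₀⁻¹ f))) := by
      have : Continuous (fun φ : A.Gelfand => φ (A.shift g₀⁻¹ f)) :=
        (WeakDual.eval_continuous _).comp continuous_subtype_val
      exact (this.comp continuous_snd).tendsto (g₀, φ₀)
    refine h1.congr_dist ?_
    have h2 : Filter.Tendsto (fun p : G × A.Gelfand => dist (A.shift g₀⁻¹ f) (A.shift p.1⁻¹ f))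
        (𝓝 (g₀, φ₀)) (𝓝 0) := by
      have : Continuous (fun p : G × A.Gelfand => dist (A.shift g₀⁻¹ f) (A.shift p.1⁻¹ f)) :=
        continuous_const.dist ((A.continuous_shift_inv f).comp continuous_fst)
      simpa using this.tendsto (g₀, φ₀)
    refine squeeze_zero (fun _ => dist_nonneg) (fun p => ?_) h2
    rw [dist_eq_norm, dist_eq_norm, ← map_sub]
    exact AlgHom.norm_apply_le_self _ _

end InvSubalgebra

/-- `(A)_ε`: the functions in `RUCb G` at distance less than `ε` from `A` in supremum norm. -/
def InvSubalgebra.nbhd (A : InvSubalgebra G) (ε : ℝ) : Set (G →ᵇ ℂ) :=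
  {f | f ∈ RUCb G ∧ ∃ a ∈ A.toStarSubalgebra, ‖f - a‖ < ε}

end Groups

/-! ### Fixed points and factors -/

/-- The action of `G` on `X` has a fixed point. -/
def HasFixedPoint (G : Type*) (X : Type*) [Group G] [MulAction G X] : Prop :=
  ∃ x : X, ∀ g : G, g • x = x

/-- `Y` is a factor of `X`: there is an equivariant continuous surjection from `X` to `Y`. -/
def IsFactor (G : Type*) (X Y : Type*) [Group G] [TopologicalSpace X] [MulAction G X]
    [TopologicalSpace Y] [MulAction G Y] : Prop :=
  ∃ π : X → Y, Continuous π ∧ Function.Surjective π ∧ ∀ (g : G) (x : X), π (g • x) = g • π x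

/-- A topological space is zero-dimensional when its clopen sets form a basis. -/
def IsZeroDimensional (X : Type*) [TopologicalSpace X] : Prop :=
  TopologicalSpace.IsTopologicalBasis {s : Set X | IsClopen s}

/-- Every zero-dimensional factor of the flow of `G` on `X` has a fixed point. Here a factor is any
compact Hausdorff space with a jointly continuous `G`-action that is a factor of `X`; being a
quotient of `X`, it may be taken in the universe of `X`. -/
def ZeroDimFactorsHaveFixedPoint (G : Type*) (X : Type u) [Group G] [TopologicalSpace G]
    [TopologicalSpace X] [MulAction G X] : Prop :=
  ∀ (Y : Type u) [TopologicalSpace Y] [CompactSpace Y] [T2Space Y] [MulAction G Y]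
    [ContinuousSMul G Y], IsZeroDimensional Y → IsFactor G X Y → HasFixedPoint G Y

/-! ### Automorphism groups of first-order structures -/

section Structures

variable (L : FirstOrder.Language.{v, w}) (F : Type u) [L.Structure F]

/-- The automorphism group of the structure `F`. -/
abbrev Aut : Type u := F ≃[L] F

instance : Group (Aut L F) where
  mul g h := g.comp h
  one := FirstOrder.Language.Equiv.refl L F
  inv g := g.symm
  mul_assoc _ _ _ := rfl
  one_mul _ := rfl
  mul_one _ := rfl
  inv_mul_cancel g := g.symm_comp_self

/-- The topology of pointwise convergence on `Aut L F`, where `F` is discrete. -/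
instance : TopologicalSpace (Aut L F) :=
  TopologicalSpace.induced (fun g : Aut L F => (g : F → F))
    (@Pi.topologicalSpace F (fun _ => F) (fun _ => ⊥))

variable {L F}

theorem isOpen_apply_eq (x y : F) : IsOpen {g : Aut L F | g x = y} := by
  let _ : TopologicalSpace F := ⊥
  have : DiscreteTopology F := ⟨rfl⟩
  have h : Continuous (fun g : Aut L F => g x) :=
    (continuous_apply x).comp continuous_induced_dom
  exact (isOpen_discrete {y}).preimage h

theorem continuous_of_isOpen {Y : Type*} [TopologicalSpace Y] {f : Y → Aut L F}
    (h : ∀ x y : F, IsOpen {t | f t x = y}) : Continuous f := by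
  let _ : TopologicalSpace F := ⊥
  have : DiscreteTopology F := ⟨rfl⟩
  refine continuous_induced_rng.2 (continuous_pi fun x => ?_)
  exact continuous_discrete_rng.2 fun y => h x y

instance : IsTopologicalGroup (Aut L F) where
  continuous_mul := continuous_of_isOpen fun x y => by
    have : {t : Aut L F × Aut L F | (t.1 * t.2) x = y}
        = ⋃ z : F, {g : Aut L F | g z = y} ×ˢ {h : Aut L F | h x = z} := by
      ext t
      simp only [Set.mem_ofPred_eq, Set.mem_iUnion, Set.mem_prod]
      exact ⟨fun h => ⟨t.2 x, h, rfl⟩, fun ⟨z, h1, h2⟩ => by rw [← h1, ← h2]; rfl⟩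
    rw [this]
    exact isOpen_iUnion fun z => (isOpen_apply_eq z y).prod (isOpen_apply_eq x z)
  continuous_inv := continuous_of_isOpen fun x y => by
    have : {g : Aut L F | g⁻¹ x = y} = {g : Aut L F | g y = x} := by
      ext g
      exact ⟨fun h => by rw [Set.mem_ofPred_eq, ← (show g.symm x = y from h)]; simp,
        fun h => by
          change g.symm x = y
          rw [← (show g y = x from h)]; simp⟩
    rw [this]
    exact isOpen_apply_eq y x

/-! ### Colourings and Ramsey properties -/

/-- Members of the age of `F`: non-empty finite substructures. -/
def InAge (S : L.Substructure F) : Prop := (S : Set F).Finite ∧ (S : Set F).Nonempty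

/-- The restriction of `g⁻¹` to `S`, an embedding of `S` into `F`. -/
def restrInv (S : L.Substructure F) (g : Aut L F) : S ↪[L] F :=
  (g⁻¹ : Aut L F).toEmbedding.comp S.subtype

/-- The function `f` on `Aut L F` is the one induced by the colouring `c` of the set of embeddings
of `S` into `F`. -/
def Induces (S : L.Substructure F) (c : (S ↪[L] F) → ℂ) (f : Aut L F →ᵇ ℂ) : Prop :=
  ∀ g, f g = c (restrInv S g)

/-- The finite colourings in a set `𝓕` of functions on `Aut L F`: those members of `𝓕` that are
induced by a finitely valued colouring of the embeddings into `F` of some member of the age. -/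
def finiteColorings (𝓕 : Set (Aut L F →ᵇ ℂ)) : Set (Aut L F →ᵇ ℂ) :=
  {f | f ∈ 𝓕 ∧ ∃ S : L.Substructure F, InAge S ∧
    ∃ c : (S ↪[L] F) → ℂ, (Set.range c).Finite ∧ Induces S c f}

/-- The embeddings of `S` into `F` with range contained in `b(T)`. -/
def embeddingsInto {S T : L.Substructure F} (b : T ↪[L] F) : Set (S ↪[L] F) :=
  {a | Set.range a ⊆ Set.range b}

/-- `F` has the Ramsey property for the finite colourings in `𝓕`. -/
def HasRamsey (𝓕 : Set (Aut L F →ᵇ ℂ)) : Prop :=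
  ∀ S T : L.Substructure F, InAge S → InAge T →
    ∀ 𝒞 : Set ((S ↪[L] F) → ℂ), 𝒞.Finite →
      (∀ c ∈ 𝒞, (Set.range c).Finite ∧ ∃ f ∈ 𝓕, Induces S c f) →
        ∃ b : T ↪[L] F, ∀ c ∈ 𝒞,
          ∀ a ∈ embeddingsInto b, ∀ a' ∈ embeddingsInto b, c a = c a'

/-- `F` has the Ramsey property up to `δ` for the finite colourings in `𝓕`. -/
def HasRamseyUpTo (δ : ℝ) (𝓕 : Set (Aut L F →ᵇ ℂ)) : Prop :=
  ∀ S T : L.Substructure F, InAge S → InAge T →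
    ∀ 𝒞 : Set ((S ↪[L] F) → ℂ), 𝒞.Finite →
      (∀ c ∈ 𝒞, (Set.range c).Finite ∧ ∃ f ∈ 𝓕, Induces S c f) →
        ∃ b : T ↪[L] F, ∀ c ∈ 𝒞,
          ∀ a ∈ embeddingsInto b, ∀ a' ∈ embeddingsInto b, ‖c a - c a'‖ < δ

end Structures

end FraisseFlow

end

open FraisseFlow

namespace FraisseFlow

/-! Write `G` for the automorphism group. Each statement reduces to one condition on `G`: for
finitely many functions `f` and a finite `H ⊆ G`, some `g` makes each `f` constant, exactly or
approximately, on `H * g`.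

On the Ramsey side this is `ramseyFor_iff`. A right uniformly continuous function of finite range is
invariant under left translation by the pointwise stabilizer of a finite substructure `S`, so it is
a colouring of embeddings of `S`. By ultrahomogeneity every copy of `T` is `g⁻¹(T)` for some `g`,
and the copies of `S` inside it come from finitely many translates `h * g`.

On the dynamical side, point evaluations are dense in the Gelfand space (`exists_eval_near`), so a
fixed character yields such a `g`; conversely compactness assembles the finite conditions into a
fixed point. Rounding to functions of finite range (`exists_finite_range_near`) leaves the algebra,
whence the neighbourhoods `A.nbhd ε` and the error `2 * ε`.

For zero-dimensional factors the conditions are exact: clopen sets pull back to 0-1 valued members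
of `A`, while finite-range members of `A` generate a factor inside a product of finite sets. Density
of the finite colourings allows rounding within `A`, which closes the circle. -/

/-- A finite set in a metric space is uniformly separated. -/
theorem exists_pos_forall_dist_lt_imp_eq {X : Type*} [MetricSpace X] {s : Set X} (hs : s.Finite) :
    ∃ ε : ℝ, 0 < ε ∧ ∀ x ∈ s, ∀ y ∈ s, dist x y < ε → x = y := by
  by_cases hn : s.Nontrivial
  · refine ⟨s.infsep, hs.infsep_pos_iff_nontrivial.2 hn, fun x hx y hy h => ?_⟩
    by_contra hne
    exact absurd (Set.infsep_le_dist_of_mem hx hy hne) (not_le.2 h)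
  · exact ⟨1, one_pos, fun x hx y hy _ => Set.not_nontrivial_iff.1 hn hx hy⟩

/-- A factor map transports fixed points. -/
theorem HasFixedPoint.of_isFactor {G X Y : Type*} [Group G] [TopologicalSpace X] [MulAction G X]
    [TopologicalSpace Y] [MulAction G Y] (hX : HasFixedPoint G X) (h : IsFactor G X Y) :
    HasFixedPoint G Y := by
  obtain ⟨x, hx⟩ := hX
  obtain ⟨π, -, -, hπ⟩ := h
  exact ⟨π x, fun g => by rw [← hπ, hx]⟩

/-! ### Gelfand spaces: density of evaluations and compactness -/

section Groups

variable {G : Type u} [Group G] [TopologicalSpace G] [IsTopologicalGroup G]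

theorem mem_RUCb_iff {f : G →ᵇ ℂ} :
    f ∈ RUCb G ↔ ∀ ε > 0, ∃ U ∈ 𝓝 (1 : G), ∀ u ∈ U, ∀ g, dist (f (u * g)) (f g) < ε := by
  have key : f ∈ RUCb G ↔ @UniformContinuous G ℂ (IsTopologicalGroup.rightUniformSpace G) _ f :=
    Iff.rfl
  rw [key]
  constructor
  · intro hf ε hε
    obtain ⟨U, hU, hUf⟩ := hf (Metric.dist_mem_uniformity hε)
    refine ⟨U, hU, fun u hu g => ?_⟩
    have h3 : (g, u * g) ∈ (fun p : G × G => p.2 * p.1⁻¹) ⁻¹' U := by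
      simpa [mul_assoc] using hu
    rw [dist_comm]
    exact hUf h3
  · intro h
    let _ := IsTopologicalGroup.rightUniformSpace G
    refine Metric.uniformity_basis_dist.tendsto_right_iff.2 fun ε hε => ?_
    obtain ⟨U, hU, hUf⟩ := h ε hε
    refine ⟨U, hU, ?_⟩
    rintro ⟨x, y⟩ hxy
    have := hUf _ hxy x
    change dist (f x) (f y) < ε
    rw [dist_comm]
    simpa [mul_assoc] using this

namespace InvSubalgebra

variable (A : InvSubalgebra G)

instance : CompleteSpace A.toStarSubalgebra := A.isClosed'.completeSpace_coe

/-- Evaluation at a point of the group, as a character. -/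
noncomputable def eval (g : G) : A.Gelfand :=
  WeakDual.CharacterSpace.equivAlgHom.symm
    { toFun := fun f : A.toStarSubalgebra => f.1 g
      map_one' := rfl
      map_mul' := fun _ _ => rfl
      map_zero' := rfl
      map_add' := fun _ _ => rfl
      commutes' := fun _ => rfl }

@[simp] theorem eval_apply (g : G) (f : A.toStarSubalgebra) : A.eval g f = f.1 g := rfl

theorem shift_inv_apply (h g : G) (f : A.toStarSubalgebra) :
    (A.shift h⁻¹ f).1 g = f.1 (h * g) := by
  change f.1 (h⁻¹⁻¹ * g) = _
  rw [inv_inv]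

theorem smul_eval (h g : G) : h • A.eval g = A.eval (h * g) :=
  WeakDual.CharacterSpace.ext fun f => A.shift_inv_apply h g f

theorem continuous_apply_gelfand (f : A.toStarSubalgebra) : Continuous fun φ : A.Gelfand => φ f :=
  (WeakDual.eval_continuous _).comp continuous_subtype_val

/-- Evaluations at points of the group are dense in the Gelfand space. -/
theorem exists_eval_near (φ : A.Gelfand) (K : Finset A.toStarSubalgebra) {η : ℝ} (hη : 0 < η) :
    ∃ g : G, ∀ f ∈ K, ‖f.1 g - φ f‖ < η := by
  by_contra! hcon
  -- `p` is the sum of the `|f - φ f|²`. It is killed by `φ`, yet is at least `η²` on all of `G` if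
  -- no `g` works. Then `M - p` has norm at most `M - η²`, while `φ` sends it to `M`, against
  -- contractivity of `φ`.
  let d : A.toStarSubalgebra → A.toStarSubalgebra := fun f => f - algebraMap ℂ _ (φ f)
  let p : A.toStarSubalgebra := ∑ f ∈ K, star (d f) * d f
  have hd : ∀ f, φ (d f) = 0 := fun f => by simp [d, AlgHomClass.commutes]
  have hp : φ p = 0 := by
    rw [map_sum]
    exact Finset.sum_eq_zero fun f _ => by rw [map_mul, hd, mul_zero]
  have hdg : ∀ f g, (d f).1 g = f.1 g - φ f := fun f g => by
    change f.1 g - (algebraMap ℂ (G →ᵇ ℂ) (φ f)) g = _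
    simp
  have hpg : ∀ g, p.1 g = ((∑ f ∈ K, ‖f.1 g - φ f‖ ^ 2 : ℝ) : ℂ) := fun g => by
    have h1 : p.1 g = A.eval g p := rfl
    rw [h1, map_sum, Complex.ofReal_sum]
    refine Finset.sum_congr rfl fun f _ => ?_
    rw [map_mul, eval_apply, eval_apply, hdg, ← Complex.normSq_eq_norm_sq,
      Complex.normSq_eq_conj_mul_self, ← hdg]
    rfl
  let M : ℝ := ‖p.1‖
  have hle : ‖(algebraMap ℂ A.toStarSubalgebra M - p).1‖ ≤ M - η ^ 2 := by
    have hb : ∀ g, η ^ 2 ≤ ∑ f ∈ K, ‖f.1 g - φ f‖ ^ 2 ∧ ∑ f ∈ K, ‖f.1 g - φ f‖ ^ 2 ≤ M := by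
      intro g
      constructor
      · obtain ⟨f, hf, h⟩ := hcon g
        exact (pow_le_pow_left₀ hη.le h 2).trans
          (Finset.single_le_sum (f := fun f : A.toStarSubalgebra => ‖f.1 g - φ f‖ ^ 2)
            (fun _ _ => by positivity) hf)
      · have := p.1.norm_coe_le_norm g
        rw [hpg, Complex.norm_real] at this
        exact (le_abs_self _).trans this
    refine (BoundedContinuousFunction.norm_le (by linarith [hb 1])).2 fun g => ?_
    have h1 : (algebraMap ℂ A.toStarSubalgebra M - p).1 g = (M : ℂ) - p.1 g := rfl
    rw [h1, hpg, ← Complex.ofReal_sub, Complex.norm_real, Real.norm_eq_abs, abs_le]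
    constructor <;> linarith [hb g]
  have hφ : ‖φ (algebraMap ℂ A.toStarSubalgebra M - p)‖ ≤
      ‖(algebraMap ℂ A.toStarSubalgebra M - p).1‖ := AlgHom.norm_apply_le_self φ _
  rw [map_sub, hp, sub_zero, AlgHomClass.commutes] at hφ
  have h2 : M ≤ ‖algebraMap ℂ ℂ M‖ := by simpa using le_abs_self M
  have : 0 < η ^ 2 := by positivity
  linarith

/-- A character takes a value of the function, if the function has finite range. -/
theorem apply_mem_range (φ : A.Gelfand) (f : A.toStarSubalgebra) (hf : (Set.range f.1).Finite) :
    φ f ∈ Set.range f.1 := by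
  rw [← hf.isClosed.closure_eq, Metric.mem_closure_iff]
  intro ε hε
  obtain ⟨g, hg⟩ := A.exists_eval_near φ {f} hε
  refine ⟨f.1 g, ⟨g, rfl⟩, ?_⟩
  rw [dist_comm, dist_eq_norm]
  exact hg f (Finset.mem_singleton_self f)

/-- A fixed point exists as soon as finitely many functions in the algebra can be made almost
invariant under finitely many translations at some point of the group. -/
theorem hasFixedPoint_of_approx
    (h : ∀ (K : Finset A.toStarSubalgebra) (H : Finset G) (η : ℝ), 0 < η →
      ∃ g, ∀ f ∈ K, ∀ k ∈ H, ‖f.1 (k * g) - f.1 g‖ ≤ η) : HasFixedPoint G A.Gelfand := by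
  classical
  let t : A.toStarSubalgebra × G × {η : ℝ // 0 < η} → Set A.Gelfand :=
    fun i => {φ | ‖(i.2.1 • φ) i.1 - φ i.1‖ ≤ i.2.2}
  have hne : (⋂ i, t i).Nonempty := by
    refine CompactSpace.iInter_nonempty (fun i => ?_) fun s => ?_
    · refine isClosed_le (Continuous.norm (Continuous.sub ?_ (A.continuous_apply_gelfand _)))
        continuous_const
      exact (A.continuous_apply_gelfand _).comp (continuous_const_smul _)
    · obtain ⟨η, hη, hle⟩ : ∃ η : ℝ, 0 < η ∧ ∀ i ∈ s, η ≤ i.2.2 := by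
        rcases s.eq_empty_or_nonempty with rfl | hs
        · exact ⟨1, one_pos, by simp⟩
        · obtain ⟨i, hi, hmin⟩ := s.exists_min_image (fun i => (i.2.2 : ℝ)) hs
          exact ⟨i.2.2, i.2.2.2, hmin⟩
      obtain ⟨g, hg⟩ := h (s.image fun i => i.1) (s.image fun i => i.2.1) η hη
      refine ⟨A.eval g, Set.mem_iInter₂.2 fun i hi => ?_⟩
      change ‖(i.2.1 • A.eval g) i.1 - A.eval g i.1‖ ≤ i.2.2
      rw [smul_eval, eval_apply, eval_apply]
      exact (hg _ (Finset.mem_image_of_mem _ hi) _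
        (Finset.mem_image_of_mem (fun i => i.2.1) hi)).trans (hle i hi)
  obtain ⟨φ, hφ⟩ := hne
  refine ⟨φ, fun g => WeakDual.CharacterSpace.ext fun f => ?_⟩
  rw [← sub_eq_zero, ← norm_le_zero_iff]
  refine le_of_forall_pos_le_add fun η hη => ?_
  rw [zero_add]
  exact Set.mem_iInter.1 hφ (f, g, ⟨η, hη⟩)

/-- A fixed point exists if finite families of functions of finite range, approximating finite
families in the algebra, can be made almost invariant under finitely many translations. -/
theorem hasFixedPoint_of_near
    (h : ∀ ε > 0, ∃ χ : A.toStarSubalgebra → (G →ᵇ ℂ), (∀ f, ‖χ f - f.1‖ < ε) ∧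
      ∀ (K : Finset A.toStarSubalgebra) (H : Finset G),
        ∃ g, ∀ f ∈ K, ∀ k ∈ H, ∀ l ∈ H, ‖χ f (k * g) - χ f (l * g)‖ < 2 * ε) :
    HasFixedPoint G A.Gelfand := by
  classical
  refine A.hasFixedPoint_of_approx fun K H η hη => ?_
  -- Two approximation errors `ε` and one oscillation `2 * ε` add up to `4 * ε = η`.
  obtain ⟨χ, hχ, hg⟩ := h (η / 4) (by linarith)
  obtain ⟨g, hg⟩ := hg K (insert 1 H)
  refine ⟨g, fun f hf k hk => ?_⟩
  have h1 := hg f hf k (Finset.mem_insert_of_mem hk) 1 (Finset.mem_insert_self 1 H)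
  rw [one_mul] at h1
  have h2 : ∀ x, ‖χ f x - f.1 x‖ < η / 4 := fun x =>
    ((χ f - f.1).norm_coe_le_norm x).trans_lt (hχ f)
  have h3 := norm_sub_le_norm_sub_add_norm_sub (f.1 (k * g)) (χ f (k * g)) (f.1 g)
  have h4 := norm_sub_le_norm_sub_add_norm_sub (χ f (k * g)) (χ f g) (f.1 g)
  rw [norm_sub_rev (f.1 (k * g)) (χ f (k * g))] at h3
  linarith [h2 (k * g), h2 g]

/-- Every continuous function on the Gelfand space comes from the algebra. -/
theorem exists_forall_apply_eq (F : C(A.Gelfand, ℂ)) :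
    ∃ f : A.toStarSubalgebra, ∀ φ : A.Gelfand, φ f = F φ := by
  obtain ⟨f, hf⟩ := (gelfandTransform_bijective A.toStarSubalgebra).2 F
  exact ⟨f, fun φ => congrArg (fun F : C(A.Gelfand, ℂ) => F φ) hf⟩

end InvSubalgebra

/-- Zero-dimensional factors have fixed points as soon as finitely many functions of finite range in
the algebra can be made invariant under finitely many translations at some point of the group. -/
theorem InvSubalgebra.zeroDimFactorsHaveFixedPoint (A : InvSubalgebra G)
    (h : ∀ (K : Finset A.toStarSubalgebra), (∀ f ∈ K, (Set.range f.1).Finite) → ∀ (H : Finset G),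
      ∃ g, ∀ f ∈ K, ∀ k ∈ H, f.1 (k * g) = f.1 g) :
    ZeroDimFactorsHaveFixedPoint G A.Gelfand := by
  classical
  rintro Y _ _ _ _ _ hzero ⟨π, hπc, -, hπ⟩
  -- The indicator of a clopen set is continuous, so by Gelfand duality its pullback is given by an
  -- element of `A`, with values in `{0, 1}`.
  have hind : ∀ U : {U : Set Y // IsClopen U}, ∃ f : A.toStarSubalgebra,
      ∀ φ : A.Gelfand, φ f = U.1.indicator (fun _ => (1 : ℂ)) (π φ) := fun U =>
    A.exists_forall_apply_eq ⟨fun φ => U.1.indicator (fun _ => (1 : ℂ)) (π φ),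
      ((continuous_const (y := (1 : ℂ))).indicator fun a ha => by
        rw [U.2.frontier_eq] at ha; exact absurd ha (Set.notMem_empty _)).comp hπc⟩
  choose f hf using hind
  let t : {U : Set Y // IsClopen U} × G → Set Y := fun i => {y | i.2 • y ∈ i.1.1 ↔ y ∈ i.1.1}
  have hne : (⋂ i, t i).Nonempty := by
    refine CompactSpace.iInter_nonempty (fun i => ?_) fun s => ?_
    · have h1 : IsClopen ((fun y => i.2 • y) ⁻¹' i.1.1) := i.1.2.preimage (continuous_const_smul _)
      have : t i = ((fun y => i.2 • y) ⁻¹' i.1.1 ∩ i.1.1) ∪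
          (((fun y => i.2 • y) ⁻¹' i.1.1)ᶜ ∩ i.1.1ᶜ) := by
        ext y
        simp only [t, Set.mem_ofPred_eq, Set.mem_union, Set.mem_inter_iff, Set.mem_compl_iff,
          Set.mem_preimage]
        tauto
      rw [this]
      exact ((h1.inter i.1.2).union (h1.compl.inter i.1.2.compl)).isClosed
    · obtain ⟨g, hg⟩ := h (s.image fun i => f i.1) (by
        intro a ha
        obtain ⟨i, -, rfl⟩ := Finset.mem_image.1 ha
        refine (Set.toFinite {(0 : ℂ), 1}).subset ?_
        rintro _ ⟨g, rfl⟩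
        have h1 := hf i.1 (A.eval g)
        rw [A.eval_apply] at h1
        rw [h1]
        by_cases hm : π (A.eval g) ∈ i.1.1 <;> simp [hm]) (s.image fun i => i.2)
      refine ⟨π (A.eval g), Set.mem_iInter₂.2 fun i hi => ?_⟩
      have h1 := hg _ (Finset.mem_image_of_mem (fun i => f i.1) hi) _
        (Finset.mem_image_of_mem (fun i => i.2) hi)
      rw [← A.eval_apply, ← A.eval_apply, hf, hf, ← A.smul_eval, hπ] at h1
      change i.2 • π (A.eval g) ∈ i.1.1 ↔ π (A.eval g) ∈ i.1.1
      by_cases ha : i.2 • π (A.eval g) ∈ i.1.1 <;> by_cases hb : π (A.eval g) ∈ i.1.1 <;>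
        simp [ha, hb] at h1 ⊢
  obtain ⟨y, hy⟩ := hne
  refine ⟨y, fun g => ?_⟩
  by_contra hne
  -- A clopen neighbourhood of `g • y` avoiding `y` would contradict `y ∈ t (U, g)`.
  obtain ⟨U, hU, hyU, hUs⟩ := hzero.mem_nhds_iff.1 (isOpen_ne.mem_nhds hne)
  exact hUs ((Set.mem_iInter.1 hy (⟨U, hU⟩, g)).1 hyU) rfl

end Groups
-- The zero-dimensional factor generated by functions of finite range
section OrbitFactor

variable {G : Type u} [Group G] [TopologicalSpace G] [IsTopologicalGroup G]

namespace InvSubalgebra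

variable (A : InvSubalgebra G)

/-- The values of a character on the translates of finitely many functions of finite range. -/
noncomputable def orbitMap (K : Set A.toStarSubalgebra)
    (hK : ∀ f ∈ K, (Set.range f.1).Finite) (φ : A.Gelfand) (i : G × K) : Set.range i.2.1.1 :=
  ⟨(i.1 • φ) i.2, A.apply_mem_range _ _ (hK _ i.2.2)⟩

variable {A} (K : Set A.toStarSubalgebra) (hK : ∀ f ∈ K, (Set.range f.1).Finite)

theorem continuous_orbitMap : Continuous (A.orbitMap K hK) :=
  continuous_pi fun _ => Continuous.subtype_mk
    ((A.continuous_apply_gelfand _).comp (continuous_const_smul _)) _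

/-- The factor of the Gelfand space generated by a set of functions of finite range. -/
def OrbitFactor : Type u := Set.range (A.orbitMap K hK)

namespace OrbitFactor

instance : TopologicalSpace (OrbitFactor K hK) :=
  inferInstanceAs (TopologicalSpace (Set.range (A.orbitMap K hK)))

instance : T2Space (OrbitFactor K hK) :=
  inferInstanceAs (T2Space (Set.range (A.orbitMap K hK)))

instance : CompactSpace (OrbitFactor K hK) :=
  isCompact_iff_compactSpace.1 (isCompact_range (continuous_orbitMap K hK))

instance : TotallyDisconnectedSpace (OrbitFactor K hK) := by
  have hfin (i : G × K) : Finite (Set.range i.2.1.1) := (hK _ i.2.2).to_subtype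
  exact inferInstanceAs (TotallyDisconnectedSpace (Set.range (A.orbitMap K hK)))

/-- The projection from the Gelfand space. -/
noncomputable def proj (φ : A.Gelfand) : OrbitFactor K hK := ⟨A.orbitMap K hK φ, φ, rfl⟩

theorem continuous_proj : Continuous (proj K hK) :=
  Continuous.subtype_mk (continuous_orbitMap K hK) _

theorem surjective_proj : Function.Surjective (proj K hK) := by
  rintro ⟨_, φ, rfl⟩
  exact ⟨φ, rfl⟩

/-- The coordinate of `φ` at `(l, f)` is `(l • φ) f`, so replacing `φ` by `k • φ` shifts the index
`l` to `l * k`. -/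
instance : MulAction G (OrbitFactor K hK) where
  smul k y := ⟨fun i => y.1 (i.1 * k, i.2), by
    obtain ⟨_, φ, rfl⟩ := y
    refine ⟨k • φ, funext fun i => Subtype.ext ?_⟩
    change (i.1 • k • φ) i.2 = ((i.1 * k) • φ) i.2
    rw [mul_smul]⟩
  one_smul y := Subtype.ext (funext fun i => by
    change y.1 (i.1 * 1, i.2) = y.1 i
    rw [mul_one])
  mul_smul k l y := Subtype.ext (funext fun i => by
    change y.1 (i.1 * (k * l), i.2) = y.1 (i.1 * k * l, i.2)
    rw [mul_assoc])

theorem proj_smul (k : G) (φ : A.Gelfand) : proj K hK (k • φ) = k • proj K hK φ :=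
  Subtype.ext (funext fun i => Subtype.ext (by
    change (i.1 • k • φ) i.2 = ((i.1 * k) • φ) i.2
    rw [mul_smul]))

/-- Joint continuity descends from the Gelfand space. The projection is proper, being continuous
from a compact to a Hausdorff space, so its product with the identity of `G` is still a quotient
map, with no local compactness of `G`. -/
instance : ContinuousSMul G (OrbitFactor K hK) where
  continuous_smul := by
    have hq : Topology.IsQuotientMap (Prod.map id (proj K hK) : G × A.Gelfand → _) :=
      (isProperMap_id.prodMap (continuous_proj K hK).isProperMap).isClosedMap.isQuotientMap
        (continuous_id.prodMap (continuous_proj K hK))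
        (Function.surjective_id.prodMap (surjective_proj K hK))
    rw [hq.continuous_iff]
    have : ((fun p : G × OrbitFactor K hK => p.1 • p.2) ∘ Prod.map id (proj K hK)) =
        fun p : G × A.Gelfand => proj K hK (p.1 • p.2) :=
      funext fun p => (proj_smul K hK p.1 p.2).symm
    rw [this]
    exact (continuous_proj K hK).comp continuous_smul

theorem isFactor : IsFactor G A.Gelfand (OrbitFactor K hK) :=
  ⟨proj K hK, continuous_proj K hK, surjective_proj K hK, proj_smul K hK⟩

end OrbitFactor

/-- If zero-dimensional factors have fixed points, then finitely many functions of finite range in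
the algebra can be made invariant under finitely many translations at some point of the group. -/
theorem exists_forall_eq_of_zeroDimFactors (A : InvSubalgebra G)
    (h : ZeroDimFactorsHaveFixedPoint G A.Gelfand) (K : Finset A.toStarSubalgebra)
    (hK : ∀ f ∈ K, (Set.range f.1).Finite) (H : Finset G) :
    ∃ g, ∀ f ∈ K, ∀ k ∈ H, ∀ l ∈ H, f.1 (k * g) = f.1 (l * g) := by
  classical
  obtain ⟨y, hy⟩ := h (OrbitFactor (K : Set A.toStarSubalgebra) hK) isTopologicalBasis_isClopen
    (OrbitFactor.isFactor _ hK)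
  -- The lift `φ` need not be fixed, but its values on `K` are invariant under translation. Those
  -- values lie in a finite set, so a close enough evaluation reproduces them exactly.
  obtain ⟨φ, rfl⟩ := OrbitFactor.surjective_proj _ hK y
  have hφ : ∀ f ∈ K, ∀ k : G, φ (A.shift k⁻¹ f) = φ f := fun f hf k => by
    have h1 := congrArg (fun y => ((y.1 (1, ⟨f, hf⟩)).1 : ℂ)) (hy k)
    change ((1 * k) • φ) f = ((1 : G) • φ) f at h1
    rw [one_mul, one_smul] at h1
    exact h1
  have hfin : (⋃ f ∈ K, Set.range f.1).Finite := K.finite_toSet.biUnion hK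
  obtain ⟨ε, hε, hsep⟩ := exists_pos_forall_dist_lt_imp_eq hfin
  obtain ⟨g, hg⟩ := A.exists_eval_near φ ((H ×ˢ K).image fun i => A.shift i.1⁻¹ i.2) hε
  have key : ∀ f ∈ K, ∀ k ∈ H, f.1 (k * g) = φ f := fun f hf k hk => by
    refine hsep _ (Set.mem_biUnion hf ⟨_, rfl⟩) _
      (Set.mem_biUnion hf (A.apply_mem_range φ f (hK f hf))) ?_
    have := hg _ (Finset.mem_image_of_mem (fun i : G × A.toStarSubalgebra => A.shift i.1⁻¹ i.2)
      (Finset.mk_mem_product hk hf))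
    rwa [A.shift_inv_apply, hφ f hf, ← dist_eq_norm] at this
  exact ⟨g, fun f hf k hk l hl => (key f hf k hk).trans (key f hf l hl).symm⟩

end InvSubalgebra
end OrbitFactor
-- Stabilizers of finite substructures and functions of finite range
section Structures

variable {L : FirstOrder.Language.{v, w}} {F : Type u} [L.Structure F]

theorem restrInv_apply (S : L.Substructure F) (g : Aut L F) (x : S) :
    restrInv S g x = g.symm x := rfl

theorem restrInv_mul_eq {S : L.Substructure F} {u : Aut L F} (hu : ∀ x ∈ S, u x = x) (g : Aut L F) :
    restrInv S (u * g) = restrInv S g := by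
  ext x
  have : u.symm (x : F) = x := by
    conv_lhs => rw [← hu x x.2]
    simp
  change g.symm (u.symm x) = g.symm x
  rw [this]

/-- With `restrInv_mul_eq`, this identifies the fibres of `restrInv S` with the right cosets of the
pointwise stabilizer of `S`. -/
theorem exists_mul_eq_of_restrInv_eq {S : L.Substructure F} {g g' : Aut L F}
    (h : restrInv S g = restrInv S g') : ∃ u : Aut L F, (∀ x ∈ S, u x = x) ∧ u * g' = g := by
  refine ⟨g * g'⁻¹, fun x hx => ?_, by group⟩
  have h1 : g.symm x = g'.symm x := DFunLike.congr_fun h (⟨x, hx⟩ : S)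
  change g (g'.symm x) = x
  rw [← h1]
  simp

/-- Pointwise stabilizers of finite sets form a neighbourhood basis of the identity. -/
theorem exists_finite_of_mem_nhds_one {U : Set (Aut L F)} (hU : U ∈ 𝓝 (1 : Aut L F)) :
    ∃ s : Set F, s.Finite ∧ ∀ u : Aut L F, (∀ x ∈ s, u x = x) → u ∈ U := by
  let _ : TopologicalSpace F := ⊥
  rw [nhds_induced, Filter.mem_comap] at hU
  obtain ⟨V, hV, hVU⟩ := hU
  rw [nhds_pi, Filter.mem_pi] at hV
  obtain ⟨s, hs, t, ht, hst⟩ := hV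
  refine ⟨s, hs, fun u hu => hVU (hst fun x hx => ?_)⟩
  change u x ∈ t x
  rw [hu x hx]
  exact mem_of_mem_nhds (ht x)

theorem stabilizer_mem_nhds_one {s : Set F} (hs : s.Finite) :
    {u : Aut L F | ∀ x ∈ s, u x = x} ∈ 𝓝 (1 : Aut L F) := by
  have : {u : Aut L F | ∀ x ∈ s, u x = x} = ⋂ x ∈ s, {u : Aut L F | u x = x} := by
    ext u; simp
  rw [this, Filter.biInter_mem hs]
  exact fun x _ => (isOpen_apply_eq x x).mem_nhds rfl

theorem exists_inAge_superset [L.IsRelational] [Nonempty F] {s : Set F} (hs : s.Finite) :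
    ∃ S : L.Substructure F, InAge S ∧ s ⊆ S := by
  obtain ⟨x⟩ := ‹Nonempty F›
  refine ⟨FirstOrder.Language.Substructure.closure L (insert x s), ?_, ?_⟩
  · rw [InAge, FirstOrder.Language.Substructure.closure_eq_of_isRelational]
    exact ⟨hs.insert x, Set.insert_nonempty x s⟩
  · rw [FirstOrder.Language.Substructure.closure_eq_of_isRelational]
    exact Set.subset_insert x s

/-- Finitely many right uniformly continuous functions are almost invariant under the pointwise
stabilizer of a member of the age. -/
theorem exists_inAge_forall_dist_lt [L.IsRelational] [Nonempty F] (K : Finset (Aut L F →ᵇ ℂ))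
    (hK : ∀ f ∈ K, f ∈ RUCb (Aut L F)) {ε : ℝ} (hε : 0 < ε) :
    ∃ S : L.Substructure F, InAge S ∧ ∀ f ∈ K, ∀ u : Aut L F, (∀ x ∈ S, u x = x) →
      ∀ g, dist (f (u * g)) (f g) < ε := by
  have h1 : ∀ f ∈ K, ∀ᶠ u in 𝓝 (1 : Aut L F), ∀ g, dist (f (u * g)) (f g) < ε := fun f hf => by
    obtain ⟨U, hU, h⟩ := mem_RUCb_iff.1 (hK f hf) ε hε
    exact Filter.mem_of_superset hU h
  obtain ⟨s, hs, h⟩ := exists_finite_of_mem_nhds_one ((Filter.eventually_all_finset K).2 h1)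
  obtain ⟨S, hS, hsS⟩ := exists_inAge_superset (L := L) hs
  exact ⟨S, hS, fun f hf u hu => h u (fun x hx => hu x (hsS hx)) f hf⟩

/-- Finitely many right uniformly continuous functions of finite range are invariant under the
pointwise stabilizer of a member of the age. -/
theorem exists_inAge_forall_eq [L.IsRelational] [Nonempty F] (K : Finset (Aut L F →ᵇ ℂ))
    (hK : ∀ f ∈ K, f ∈ RUCb (Aut L F)) (hK' : ∀ f ∈ K, (Set.range f).Finite) :
    ∃ S : L.Substructure F, InAge S ∧ ∀ f ∈ K, ∀ u : Aut L F, (∀ x ∈ S, u x = x) →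
      ∀ g, f (u * g) = f g := by
  have hfin : (⋃ f ∈ K, Set.range f).Finite := K.finite_toSet.biUnion hK'
  obtain ⟨ε, hε, hsep⟩ := exists_pos_forall_dist_lt_imp_eq hfin
  obtain ⟨S, hS, h⟩ := exists_inAge_forall_dist_lt (L := L) K hK hε
  exact ⟨S, hS, fun f hf u hu g => hsep _ (Set.mem_biUnion hf ⟨_, rfl⟩) _
    (Set.mem_biUnion hf ⟨_, rfl⟩) (h f hf u hu g)⟩

/-- Right uniformly continuous functions are uniform limits of functions of finite range. -/
theorem exists_finite_range_near [L.IsRelational] [Nonempty F] {f : Aut L F →ᵇ ℂ}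
    (hf : f ∈ RUCb (Aut L F)) {ε : ℝ} (hε : 0 < ε) :
    ∃ χ ∈ RUCb (Aut L F), (Set.range χ).Finite ∧ ‖χ - f‖ < ε := by
  have hε4 : 0 < ε / 4 := by linarith
  obtain ⟨S, hS, hSf⟩ := exists_inAge_forall_dist_lt (L := L) {f} (by simpa using hf) hε4
  have htb : TotallyBounded (Set.range f) :=
    (Metric.isBounded_iff_subset_closedBall 0).1 f.isBounded_range |>.elim fun r hr =>
      (isCompact_closedBall (0 : ℂ) r).totallyBounded.subset hr
  obtain ⟨t, ht, hcov⟩ := Metric.totallyBounded_iff.1 htb (ε / 4) hε4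
  have hnet : ∀ g, ∃ y ∈ t, dist (f g) y < ε / 4 := fun g => by
    simpa using hcov ⟨g, rfl⟩
  choose r hrt hr using hnet
  -- Rounding `f g` directly need not respect cosets of the stabilizer. Rounding at one
  -- representative per coset does, and costs only a further `ε / 4`.
  let rep : Aut L F → Aut L F := fun g => Function.invFun (restrInv S) (restrInv S g)
  have hrep : ∀ g, restrInv S (rep g) = restrInv S g := fun g =>
    Function.invFun_eq ⟨g, rfl⟩
  have hinv : ∀ u : Aut L F, (∀ x ∈ S, u x = x) → ∀ g, r (rep (u * g)) = r (rep g) :=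
    fun u hu g => by simp only [rep, restrInv_mul_eq hu g]
  have hcont : Continuous fun g => r (rep g) := by
    refine IsLocallyConstant.continuous ((IsLocallyConstant.iff_eventually_eq _).2 fun g => ?_)
    have h1 : Filter.Tendsto (fun k : Aut L F => k * g⁻¹) (𝓝 g) (𝓝 1) := by
      have : Continuous (fun k : Aut L F => k * g⁻¹) := continuous_mul_const _
      simpa using this.tendsto g
    filter_upwards [h1 (stabilizer_mem_nhds_one hS.1)] with k hk
    have := hinv _ hk g
    simpa using this
  obtain ⟨C, hC⟩ := Metric.isBounded_iff.1 ht.isBounded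
  let χ : Aut L F →ᵇ ℂ := ⟨⟨fun g => r (rep g), hcont⟩, C, fun g g' => hC (hrt _) (hrt _)⟩
  have hχ : ∀ g, χ g = r (rep g) := fun _ => rfl
  refine ⟨χ, mem_RUCb_iff.2 fun δ hδ => ⟨_, stabilizer_mem_nhds_one hS.1, fun u hu g => ?_⟩,
    ht.subset ?_, ?_⟩
  · rw [hχ, hχ, hinv u hu, dist_self]
    exact hδ
  · rintro _ ⟨g, rfl⟩
    exact hrt _
  · refine lt_of_le_of_lt ((BoundedContinuousFunction.norm_le (half_pos hε).le).2 fun g => ?_)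
      (half_lt_self hε)
    obtain ⟨u, hu, hug⟩ := exists_mul_eq_of_restrInv_eq (hrep g)
    have h1 := hSf f (Finset.mem_singleton_self f) u hu g
    rw [hug] at h1
    have h2 := hr (rep g)
    change ‖r (rep g) - f g‖ ≤ _
    rw [← dist_eq_norm]
    have h3 := dist_triangle_left (r (rep g)) (f g) (f (rep g))
    linarith

/-! ### The Ramsey property as a condition on the automorphism group -/

/-- The common form of the exact and the approximate Ramsey property. -/
def RamseyFor (R : ℂ → ℂ → Prop) (𝓕 : Set (Aut L F →ᵇ ℂ)) : Prop :=
  ∀ S T : L.Substructure F, InAge S → InAge T →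
    ∀ 𝒞 : Set ((S ↪[L] F) → ℂ), 𝒞.Finite →
      (∀ c ∈ 𝒞, (Set.range c).Finite ∧ ∃ f ∈ 𝓕, Induces S c f) →
        ∃ b : T ↪[L] F, ∀ c ∈ 𝒞,
          ∀ a ∈ embeddingsInto b, ∀ a' ∈ embeddingsInto b, R (c a) (c a')

/-- Ultrahomogeneity enters the argument only here. -/
theorem exists_restrInv_eq (hF : L.IsUltrahomogeneous F) {S : L.Substructure F} (hS : InAge S)
    (a : S ↪[L] F) : ∃ g : Aut L F, restrInv S g = a := by
  have hfg : S.FG := by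
    have := FirstOrder.Language.Substructure.fg_closure (L := L) hS.1
    rwa [FirstOrder.Language.Substructure.closure_eq] at this
  obtain ⟨g, hg⟩ := hF S hfg a
  exact ⟨g⁻¹, hg.symm⟩

/-- The Ramsey property in terms of the automorphism group. -/
theorem ramseyFor_iff [L.IsRelational] [Nonempty F] (hF : L.IsUltrahomogeneous F)
    (R : ℂ → ℂ → Prop) {𝓕 : Set (Aut L F →ᵇ ℂ)} (h𝓕 : ∀ f ∈ 𝓕, f ∈ RUCb (Aut L F)) :
    RamseyFor R 𝓕 ↔ ∀ K : Finset (Aut L F →ᵇ ℂ), (∀ f ∈ K, f ∈ 𝓕 ∧ (Set.range f).Finite) →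
      ∀ H : Finset (Aut L F), ∃ g, ∀ f ∈ K, ∀ h ∈ H, ∀ h' ∈ H, R (f (h * g)) (f (h' * g)) := by
  classical
  constructor
  · intro hR K hK H
    obtain ⟨S, hS, hSK⟩ := exists_inAge_forall_eq (L := L) K (fun f hf => h𝓕 f (hK f hf).1)
      fun f hf => (hK f hf).2
    -- `T` contains every `h⁻¹(S)`, so the embeddings `restrInv S (h * g)` all land in `g⁻¹(T)`.
    obtain ⟨T, hT, hST⟩ := exists_inAge_superset (L := L) (F := F)
      (s := ⋃ h ∈ H, h.symm '' (S : Set F)) (H.finite_toSet.biUnion fun h _ => hS.1.image _)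
    -- The choice of preimage is harmless: `f` is constant on the fibres of `restrInv S`.
    let col : (Aut L F →ᵇ ℂ) → (S ↪[L] F) → ℂ := fun f a => f (Function.invFun (restrInv S) a)
    have hcol : ∀ f ∈ K, Induces S (col f) f := fun f hf g => by
      obtain ⟨u, hu, hug⟩ := exists_mul_eq_of_restrInv_eq
        (Function.invFun_eq (f := restrInv S) (b := restrInv S g) ⟨g, rfl⟩)
      change f g = f _
      rw [← hug, hSK f hf u hu]
    obtain ⟨b, hb⟩ := hR S T hS hT (col '' K) (K.finite_toSet.image _) (by
      rintro _ ⟨f, hf, rfl⟩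
      refine ⟨(hK f hf).2.subset ?_, f, (hK f hf).1, hcol f hf⟩
      rintro _ ⟨a, rfl⟩
      exact ⟨_, rfl⟩)
    obtain ⟨g, rfl⟩ := exists_restrInv_eq hF hT b
    have hmem : ∀ h ∈ H, restrInv S (h * g) ∈ embeddingsInto (S := S) (restrInv T g) := by
      rintro h hh _ ⟨x, rfl⟩
      exact ⟨⟨h.symm x, hST (Set.mem_biUnion hh ⟨x, x.2, rfl⟩)⟩, rfl⟩
    refine ⟨g, fun f hf h hh h' hh' => ?_⟩
    rw [hcol f hf, hcol f hf (h' * g)]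
    exact hb _ ⟨f, hf, rfl⟩ _ (hmem h hh) _ (hmem h' hh')
  · intro hG S T hS hT 𝒞 h𝒞 hcol
    have hS' : Finite S := hS.1.to_subtype
    have hT' : Finite T := hT.1.to_subtype
    choose! f hf using fun c hc => (hcol c hc).2
    have hfin : {a : S ↪[L] F | Set.range a ⊆ (T : Set F)}.Finite := by
      refine Set.Finite.of_finite_image (f := fun a x => a x) ?_ DFunLike.coe_injective.injOn
      refine (Set.Finite.pi' (fun _ : S => hT.1)).subset ?_
      rintro _ ⟨a, ha, rfl⟩ x
      exact ha ⟨x, rfl⟩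
    choose k hk using exists_restrInv_eq hF hS
    obtain ⟨g, hg⟩ := hG (h𝒞.toFinset.image f) (by
      intro f' hf'
      obtain ⟨c, hc, rfl⟩ := Finset.mem_image.1 hf'
      rw [Set.Finite.mem_toFinset] at hc
      refine ⟨(hf c hc).1, (hcol c hc).1.subset ?_⟩
      rintro _ ⟨g, rfl⟩
      exact ⟨_, ((hf c hc).2 g).symm⟩) (hfin.toFinset.image k)
    have hlift : ∀ a ∈ embeddingsInto (S := S) (restrInv T g),
        ∃ h ∈ hfin.toFinset.image k, restrInv S (h * g) = a := by
      intro a ha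
      -- Composing with `g` carries a copy of `S` in `g⁻¹(T)` into `T`, where only finitely many
      -- embeddings exist; `H` was chosen to realize those.
      refine ⟨k (g.toEmbedding.comp a), Finset.mem_image_of_mem _ (hfin.mem_toFinset.2 ?_), ?_⟩
      · rintro _ ⟨x, rfl⟩
        obtain ⟨y, hy⟩ := ha ⟨x, rfl⟩
        change g (a x) ∈ (T : Set F)
        rw [← hy, restrInv_apply]
        simp
      · ext x
        have h1 : (k (g.toEmbedding.comp a)).symm x = g (a x) :=
          DFunLike.congr_fun (hk (g.toEmbedding.comp a)) x
        change g.symm ((k (g.toEmbedding.comp a)).symm x) = a x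
        rw [h1]
        simp
    refine ⟨restrInv T g, fun c hc a ha a' ha' => ?_⟩
    obtain ⟨h, hh, rfl⟩ := hlift a ha
    obtain ⟨h', hh', rfl⟩ := hlift a' ha'
    rw [← (hf c hc).2, ← (hf c hc).2]
    exact hg _ (Finset.mem_image_of_mem _ (h𝒞.mem_toFinset.2 hc)) h hh h' hh'

end Structures
-- The implications between the four statements
section Main

variable {L : FirstOrder.Language.{v, w}} [L.IsRelational] {F : Type u} [L.Structure F] [Nonempty F]

/-- If `a f` in `A` approximates `f`, the number `φ (a f)`, for a fixed `φ`, is the centre of a disc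
of radius `ε` containing all values `f (k * g)`, whence `2 * ε`. -/
theorem hasRamseyUpTo_of_hasFixedPoint (hF : L.IsUltrahomogeneous F) (A : InvSubalgebra (Aut L F))
    (h : HasFixedPoint (Aut L F) A.Gelfand) {ε : ℝ} : HasRamseyUpTo (2 * ε) (A.nbhd ε) := by
  classical
  refine (ramseyFor_iff hF (fun x y => ‖x - y‖ < 2 * ε) (fun f hf => hf.1)).2 fun K hK H => ?_
  obtain ⟨φ, hφ⟩ := h
  choose! a haA ha using fun f hf => (hK f hf).1.2
  -- The strict bounds `‖f - a f‖ < ε` leave a common slack over the finite `K`, spent on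
  -- approximating `φ` by an evaluation.
  obtain ⟨δ, hδ, hδK⟩ : ∃ δ > 0, ∀ f ∈ K, ‖f - a f‖ + δ ≤ ε := by
    rcases K.eq_empty_or_nonempty with rfl | hne
    · exact ⟨1, one_pos, by simp⟩
    · obtain ⟨f, hf, hmax⟩ := K.exists_max_image (fun f => ‖f - a f‖) hne
      exact ⟨ε - ‖f - a f‖, sub_pos.2 (ha f hf), fun f' hf' => by linarith [hmax f' hf']⟩
  let a' : K → A.toStarSubalgebra := fun f => ⟨a f, haA f f.2⟩
  obtain ⟨g, hg⟩ := A.exists_eval_near φ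
    ((H ×ˢ K.attach).image fun i => A.shift i.1⁻¹ (a' i.2)) hδ
  have key : ∀ f, ∀ hf : f ∈ K, ∀ k ∈ H, ‖f (k * g) - φ (a' ⟨f, hf⟩)‖ < ε := by
    intro f hf k hk
    have h1 := hg _ (Finset.mem_image_of_mem
      (fun i : Aut L F × K => A.shift i.1⁻¹ (a' i.2))
      (Finset.mk_mem_product hk (Finset.mem_attach K ⟨f, hf⟩)))
    have h2 : φ (A.shift k⁻¹ (a' ⟨f, hf⟩)) = φ (a' ⟨f, hf⟩) := by
      rw [← A.smul_apply, hφ]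
    rw [A.shift_inv_apply, h2] at h1
    have h3 : ‖f (k * g) - a f (k * g)‖ ≤ ‖f - a f‖ := (f - a f).norm_coe_le_norm (k * g)
    have h4 := norm_sub_le_norm_sub_add_norm_sub (f (k * g)) (a f (k * g)) (φ (a' ⟨f, hf⟩))
    change ‖a f (k * g) - φ (a' ⟨f, hf⟩)‖ < δ at h1
    linarith [hδK f hf]
  refine ⟨g, fun f hf k hk l hl => ?_⟩
  have h1 := key f hf k hk
  have h2 := key f hf l hl
  have h3 := norm_sub_le_norm_sub_add_norm_sub (f (k * g)) (φ (a' ⟨f, hf⟩)) (f (l * g))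
  rw [norm_sub_rev (φ _)] at h3
  linarith

theorem hasFixedPoint_of_hasRamseyUpTo (hF : L.IsUltrahomogeneous F) (A : InvSubalgebra (Aut L F))
    (h : ∀ ε : ℝ, 0 < ε → HasRamseyUpTo (2 * ε) (A.nbhd ε)) :
    HasFixedPoint (Aut L F) A.Gelfand := by
  classical
  refine A.hasFixedPoint_of_near fun ε hε => ?_
  choose χ hχ hfin hnear using fun f : A.toStarSubalgebra =>
    exists_finite_range_near (A.le_RUCb f.2) hε
  refine ⟨χ, hnear, fun K H => ?_⟩
  obtain ⟨g, hg⟩ := (ramseyFor_iff hF (fun x y => ‖x - y‖ < 2 * ε) (fun f hf => hf.1)).1 (h ε hε)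
    (K.image χ) (by
      intro f hf
      obtain ⟨a, -, rfl⟩ := Finset.mem_image.1 hf
      exact ⟨⟨hχ a, a.1, a.2, hnear a⟩, hfin a⟩) H
  exact ⟨g, fun f hf => hg _ (Finset.mem_image_of_mem χ hf)⟩

theorem hasRamsey_iff (hF : L.IsUltrahomogeneous F) (A : InvSubalgebra (Aut L F)) :
    HasRamsey (A.toStarSubalgebra : Set (Aut L F →ᵇ ℂ)) ↔
      ∀ K : Finset A.toStarSubalgebra, (∀ f ∈ K, (Set.range f.1).Finite) →
        ∀ H : Finset (Aut L F), ∃ g, ∀ f ∈ K, ∀ k ∈ H, ∀ l ∈ H, f.1 (k * g) = f.1 (l * g) := by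
  classical
  refine (ramseyFor_iff hF (fun x y => x = y) (fun f hf => A.le_RUCb hf)).trans
    ⟨fun h K hK H => ?_, fun h K hK H => ?_⟩
  · obtain ⟨g, hg⟩ := h (K.image Subtype.val) (by
      intro f hf
      obtain ⟨a, ha, rfl⟩ := Finset.mem_image.1 hf
      exact ⟨a.2, hK a ha⟩) H
    exact ⟨g, fun f hf => hg _ (Finset.mem_image_of_mem _ hf)⟩
  · let ι : K → A.toStarSubalgebra := fun f => ⟨f.1, (hK f.1 f.2).1⟩
    obtain ⟨g, hg⟩ := h (K.attach.image ι) (by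
      intro f hf
      obtain ⟨a, -, rfl⟩ := Finset.mem_image.1 hf
      exact (hK a.1 a.2).2) H
    exact ⟨g, fun f hf => hg (ι ⟨f, hf⟩) (Finset.mem_image_of_mem ι (Finset.mem_attach _ _))⟩

theorem zeroDimFactorsHaveFixedPoint_iff_hasRamsey (hF : L.IsUltrahomogeneous F)
    (A : InvSubalgebra (Aut L F)) :
    ZeroDimFactorsHaveFixedPoint (Aut L F) A.Gelfand ↔
      HasRamsey (A.toStarSubalgebra : Set (Aut L F →ᵇ ℂ)) := by
  classical
  rw [hasRamsey_iff hF]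
  refine ⟨A.exists_forall_eq_of_zeroDimFactors, fun h =>
    A.zeroDimFactorsHaveFixedPoint fun K hK H => ?_⟩
  obtain ⟨g, hg⟩ := h K hK (insert 1 H)
  refine ⟨g, fun f hf k hk => ?_⟩
  simpa using hg f hf k (Finset.mem_insert_of_mem hk) 1 (Finset.mem_insert_self 1 H)

/-- The approximants now lie in `A`, so the exact Ramsey property applies to them. They may colour
embeddings of different substructures; the group form `hasRamsey_iff` treats them together. -/
theorem hasFixedPoint_of_hasRamsey_of_dense (hF : L.IsUltrahomogeneous F)
    (A : InvSubalgebra (Aut L F))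
    (hd : ∀ f ∈ A.toStarSubalgebra,
      f ∈ closure (finiteColorings (A.toStarSubalgebra : Set (Aut L F →ᵇ ℂ))))
    (h : HasRamsey (A.toStarSubalgebra : Set (Aut L F →ᵇ ℂ))) :
    HasFixedPoint (Aut L F) A.Gelfand := by
  classical
  refine A.hasFixedPoint_of_near fun ε hε => ?_
  choose χ hχ hnear using fun f : A.toStarSubalgebra => Metric.mem_closure_iff.1 (hd f.1 f.2) ε hε
  have hfin : ∀ f, (Set.range (χ f)).Finite := fun f => by
    obtain ⟨S, -, c, hc, hind⟩ := (hχ f).2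
    refine hc.subset ?_
    rintro _ ⟨g, rfl⟩
    exact ⟨_, (hind g).symm⟩
  refine ⟨χ, fun f => by rw [← dist_eq_norm, dist_comm]; exact hnear f, fun K H => ?_⟩
  obtain ⟨g, hg⟩ := (hasRamsey_iff hF A).1 h (K.image fun f => ⟨χ f, (hχ f).1⟩) (by
    intro f hf
    obtain ⟨a, -, rfl⟩ := Finset.mem_image.1 hf
    exact hfin a) H
  refine ⟨g, fun f hf k hk l hl => ?_⟩
  have h1 : χ f (k * g) = χ f (l * g) :=
    hg _ (Finset.mem_image_of_mem (fun f => (⟨χ f, (hχ f).1⟩ : A.toStarSubalgebra)) hf) k hk l hl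
  rw [h1, sub_self, norm_zero]
  linarith

end Main
end FraisseFlow

theorem mainTheorem2 {L : FirstOrder.Language.{v, w}} [L.IsRelational]
    {F : Type u} [L.Structure F] [Countable F] [Nonempty F]
    (hF : L.IsUltrahomogeneous F) (A : InvSubalgebra (Aut L F)) :
    -- (i) iff (ii)
    (HasFixedPoint (Aut L F) A.Gelfand ↔
      ∀ ε : ℝ, 0 < ε → HasRamseyUpTo (2 * ε) (A.nbhd ε)) ∧
    -- (i) implies (iii)
    (HasFixedPoint (Aut L F) A.Gelfand → ZeroDimFactorsHaveFixedPoint (Aut L F) A.Gelfand) ∧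
    -- (iii) iff (iv)
    (ZeroDimFactorsHaveFixedPoint (Aut L F) A.Gelfand ↔
      HasRamsey (A.toStarSubalgebra : Set (Aut L F →ᵇ ℂ))) ∧
    -- all four are equivalent when the finite colourings in `A` are dense in `A`
    ((∀ f ∈ A.toStarSubalgebra, f ∈ closure (finiteColorings (A.toStarSubalgebra : Set (Aut L F →ᵇ ℂ)))) →
      List.TFAE [
        HasFixedPoint (Aut L F) A.Gelfand,
        ∀ ε : ℝ, 0 < ε → HasRamseyUpTo (2 * ε) (A.nbhd ε),
        ZeroDimFactorsHaveFixedPoint (Aut L F) A.Gelfand,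
        HasRamsey (A.toStarSubalgebra : Set (Aut L F →ᵇ ℂ))]) := by
  have h12 : HasFixedPoint (Aut L F) A.Gelfand ↔
      ∀ ε : ℝ, 0 < ε → HasRamseyUpTo (2 * ε) (A.nbhd ε) :=
    ⟨fun h _ _ => hasRamseyUpTo_of_hasFixedPoint hF A h, hasFixedPoint_of_hasRamseyUpTo hF A⟩
  have h13 : HasFixedPoint (Aut L F) A.Gelfand →
      ZeroDimFactorsHaveFixedPoint (Aut L F) A.Gelfand :=
    fun h _ _ _ _ _ _ _ hY => h.of_isFactor hY
  have h34 := zeroDimFactorsHaveFixedPoint_iff_hasRamsey hF A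
  refine ⟨h12, h13, h34, fun hd => ?_⟩
  tfae_have 1 ↔ 2 := h12
  tfae_have 1 → 3 := h13
  tfae_have 3 ↔ 4 := h34
  tfae_have 4 → 1 := hasFixedPoint_of_hasRamsey_of_dense hF A hd
  tfae_finish
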